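/- Let $G=(V,E)$ be a finite simple graph. Two disjoint sets $A,B\subseteq V$ are \emph{twins} if $|A|=|B|$ and the induced subgraphs $G[A]$ and $G[B]$ have the same number of edges. Given twins $A,B$, call the vertices of $A\cup B$ \emph{colored} and all other vertices \emph{uncolored}, call $G[A\cup B]$ the \emph{colored graph}, and let $S$ be the set of all colored vertices that have at least one uncolored neighbor in $G$. A \emph{leaf} of the colored graph is a colored vertex of degree $1$ in $G[A\cup B]$; every other colored vertex is a \emph{non-leaf} of the colored graph. Twins $A,B$ are called \emph{good twins} if (1) every uncolored vertex has degree at most $1$ in $G$; (2) the colored graph $G[A\cup B]$ has no isolated vertices; (3) $S\subseteq A$ and $|S|\le 2$; (4) $S$ contains at most one leaf and at most one non-leaf of the colored graph; (5) if $w\in S$ is a non-leaf of the colored graph, then $w$ has at most one neighbor in $A$; (6) if $w\in S$ is a non-leaf and $v\in S$ is a leaf of the colored graph, then $v$ has fewer uncolored neighbors than $w$. \textbf{Theorem.} Every finite forest $G$ has good twins. -/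

import Mathlib

/-- The number of edges of the subgraph of `G` induced by the vertex set `A`. -/
noncomputable def inducedEdgeCount {V : Type*} (G : SimpleGraph V) (A : Finset V) : ℕ :=
  (G.induce (A : Set V)).edgeSet.ncard

/-- `A` and `B` are twins in `G`: disjoint vertex sets of the same size that induce subgraphs
with the same number of edges. -/
structure IsTwins {V : Type*} (G : SimpleGraph V) (A B : Finset V) : Prop where
  disjoint : Disjoint A B
  card_eq : A.card = B.card
  edges_eq : inducedEdgeCount G A = inducedEdgeCount G B

section GoodTwins

variable {V : Type*} [Fintype V] [DecidableEq V] (G : SimpleGraph V) [DecidableRel G.Adj]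

/-- The number of neighbors of `x` that lie in `X`. For `x ∈ X` this is the degree of `x` in the
induced subgraph `G[X]`. -/
def degreeIn (X : Finset V) (x : V) : ℕ :=
  (G.neighborFinset x ∩ X).card

/-- The number of uncolored neighbors of `x`, where the colored vertices are those of `A ∪ B`. -/
def uncoloredDegree (A B : Finset V) (x : V) : ℕ :=
  (G.neighborFinset x \ (A ∪ B)).card

/-- `x` is a leaf of the colored graph `G[A ∪ B]`. -/
def IsColoredLeaf (A B : Finset V) (x : V) : Prop :=
  x ∈ A ∪ B ∧ degreeIn G (A ∪ B) x = 1

/-- `x` is a non-leaf of the colored graph `G[A ∪ B]`. -/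
def IsColoredNonleaf (A B : Finset V) (x : V) : Prop :=
  x ∈ A ∪ B ∧ degreeIn G (A ∪ B) x ≠ 1

/-- The set `S` of colored vertices that do not have all their neighbors colored. -/
def exposedSet (A B : Finset V) : Finset V :=
  (A ∪ B).filter fun x => ¬ G.neighborFinset x ⊆ A ∪ B

/-- `A` and `B` are good twins in `G`. -/
structure IsGoodTwins (A B : Finset V) : Prop where
  twins : IsTwins G A B
  uncolored_degree_le_one : ∀ x, x ∉ A ∪ B → G.degree x ≤ 1
  colored_not_isolated : ∀ x ∈ A ∪ B, degreeIn G (A ∪ B) x ≠ 0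
  exposed_subset : exposedSet G A B ⊆ A
  exposed_card_le_two : (exposedSet G A B).card ≤ 2
  exposed_leaf_unique : ∀ x ∈ exposedSet G A B, ∀ y ∈ exposedSet G A B,
    IsColoredLeaf G A B x → IsColoredLeaf G A B y → x = y
  exposed_nonleaf_unique : ∀ x ∈ exposedSet G A B, ∀ y ∈ exposedSet G A B,
    IsColoredNonleaf G A B x → IsColoredNonleaf G A B y → x = y
  exposed_nonleaf_degree : ∀ w ∈ exposedSet G A B,
    IsColoredNonleaf G A B w → degreeIn G A w ≤ 1
  exposed_leaf_lt_nonleaf : ∀ w ∈ exposedSet G A B, ∀ v ∈ exposedSet G A B,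
    IsColoredNonleaf G A B w → IsColoredLeaf G A B v →
      uncoloredDegree G A B v < uncoloredDegree G A B w

end GoodTwins

/-!
Give a vertex of degree `d ≥ 1` the weight `d - 1`, so that leaves are weightless. Disjoint sets
`A`, `B` of the same size span equally many edges exactly when their vertices have the same total
weight in the colored graph, because an edge between `A` and `B` counts once on each side.

Hence the inner vertices (those of degree at least `2`) have to be balanced by weight, and then the
leaves serve to balance the cardinalities. The weights need not balance exactly: if the side `P` is
heavier than `Q` by `D`, then `D` leaves at a single vertex `e ∈ P` are left uncolored, together
with the isolated vertices, which are always left uncolored. No other vertex is then exposed, so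
that of the conditions on the exposed set only the one on the neighbors of `e` in `A` remains. Such
a division is an `IsSplit`. It exists by a greedy procedure (`exists_isSplit`): inner vertices are
inserted in an order in which each has at most one earlier neighbor, always on the lighter side;
either the difference shrinks, or it changes sign and is absorbed by the new vertex.

A forest with `n` vertices and `c` components has degree sum `2 * n - 2 * c`, which provides enough
leaves, in the right parity, to make the two sides equally large. It may still be impossible to give
enough of the leaves at `e` the color of `Q`. In that case `Q` has many vertices compared with the
total weight, so one of those not adjacent to `e` is light (`IsSplit.exists_movable`) and can be
moved to `P`, which makes `D` larger. As `D` is less than the degree of `e`, this ends with a split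
whose leaves can be colored (`IsSplit.exists_isGoodTwins`).
-/

/-! ### Forests and degrees inside a vertex set -/

section Degrees

variable {V : Type*} [Fintype V] [DecidableEq V] {G : SimpleGraph V} [DecidableRel G.Adj]

lemma degreeIn_eq_card_filter (X : Finset V) (x : V) :
    degreeIn G X x = (X.filter (G.Adj x)).card := by
  unfold degreeIn
  congr 1
  ext y
  simp [and_comm]

lemma degreeIn_mono {X Y : Finset V} (h : X ⊆ Y) (x : V) : degreeIn G X x ≤ degreeIn G Y x :=
  Finset.card_le_card (Finset.inter_subset_inter_left h)

lemma degreeIn_union {X Y : Finset V} (h : Disjoint X Y) (x : V) :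
    degreeIn G (X ∪ Y) x = degreeIn G X x + degreeIn G Y x := by
  simp only [degreeIn_eq_card_filter]
  rw [Finset.filter_union, Finset.card_union_of_disjoint (Finset.disjoint_filter_filter h)]

lemma degreeIn_insert {X : Finset V} {c : V} (hc : c ∉ X) (x : V) :
    degreeIn G (insert c X) x = degreeIn G X x + if G.Adj x c then 1 else 0 := by
  simp only [degreeIn_eq_card_filter, Finset.filter_insert]
  split_ifs with h
  · exact Finset.card_insert_of_notMem (by simp [hc])
  · simp

/-- Double counting of the edges between two vertex sets. -/
lemma sum_degreeIn_comm (X Y : Finset V) :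
    ∑ x ∈ X, degreeIn G Y x = ∑ y ∈ Y, degreeIn G X y := by
  simp only [degreeIn_eq_card_filter]
  have h := Finset.sum_card_bipartiteAbove_eq_sum_card_bipartiteBelow (s := X) (t := Y) G.Adj
  simpa only [Finset.bipartiteAbove, Finset.bipartiteBelow, G.adj_comm] using h

/-- The degree-sum formula for an induced subgraph. -/
lemma sum_degreeIn_self (X : Finset V) :
    ∑ x ∈ X, degreeIn G X x = 2 * inducedEdgeCount G X := by
  classical
  have h := (G.induce (X : Set V)).sum_degrees_eq_twice_card_edges
  have hE : inducedEdgeCount G X = (G.induce (X : Set V)).edgeFinset.card := by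
    rw [inducedEdgeCount, Set.ncard_eq_toFinset_card', SimpleGraph.edgeFinset]
  rw [hE, ← h, ← Finset.sum_coe_sort X]
  refine Finset.sum_congr rfl fun x _ => ?_
  rw [degreeIn_eq_card_filter, ← SimpleGraph.card_neighborFinset_eq_degree]
  refine (Finset.card_bij (fun (y : (X : Set V)) _ => (y : V)) ?_ ?_ ?_).symm
  · intro y hy
    have hy' := y.2
    simp_all
  · intro a _ b _ hab
    exact Subtype.ext hab
  · intro b hb
    rw [Finset.mem_filter] at hb
    exact ⟨⟨b, hb.1⟩, by simpa using hb.2, rfl⟩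

/-- An endpoint of a longest path of an induced subgraph of a forest has at most one neighbor in
that subgraph. -/
lemma exists_degreeIn_le_one (hG : G.IsAcyclic) {M : Finset V} (hM : M.Nonempty) :
    ∃ c ∈ M, degreeIn G M c ≤ 1 := by
  classical
  have : Nonempty (M : Set V) := hM.to_subtype
  obtain ⟨u, v, p, hp, hmax⟩ :=
    SimpleGraph.Walk.exists_isPath_forall_isPath_length_le_length (G.induce (M : Set V))
  refine ⟨u, u.2, ?_⟩
  have key : ∀ w (hw : w ∈ M), G.Adj u w → w = p.snd := by
    intro w hw huw
    have hadj : (G.induce (M : Set V)).Adj u ⟨w, hw⟩ := huw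
    have hs : (⟨w, hw⟩ : (M : Set V)) ∈ p.support := by
      by_contra hs
      have := hmax _ _ (.cons hadj.symm p) (hp.cons hs)
      simp at this
    exact congrArg Subtype.val ((hG.induce _).eq_snd_of_adj_start hp hadj hs)
  rw [degreeIn_eq_card_filter, Finset.card_le_one]
  intro a ha b hb
  rw [Finset.mem_filter] at ha hb
  rw [key a ha.1 ha.2, key b hb.1 hb.2]

/-- The number `c` below is the number of connected components of the induced forest. -/
lemma exists_sum_degreeIn_add_two_mul (hG : G.IsAcyclic) {X : Finset V} (hX : X.Nonempty) :
    ∃ c, 1 ≤ c ∧ ∑ x ∈ X, degreeIn G X x + 2 * c = 2 * X.card := by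
  induction hn : X.card generalizing X with
  | zero => simp_all
  | succ n ih =>
    obtain ⟨v, hv, hd⟩ := exists_degreeIn_le_one hG hX
    obtain ⟨Y, hvY, rfl⟩ : ∃ Y, v ∉ Y ∧ X = insert v Y :=
      ⟨X.erase v, by simp, (Finset.insert_erase hv).symm⟩
    rw [Finset.card_insert_of_notMem hvY] at hn
    have hsum : ∑ x ∈ insert v Y, degreeIn G (insert v Y) x
        = ∑ x ∈ Y, degreeIn G Y x + 2 * degreeIn G Y v := by
      rw [Finset.sum_insert hvY]
      simp only [degreeIn_insert hvY, Finset.sum_add_distrib]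
      have : ∑ x ∈ Y, (if G.Adj x v then 1 else 0) = degreeIn G Y v := by
        rw [degreeIn_eq_card_filter, Finset.card_filter]
        simp only [G.adj_comm]
      rw [this]
      simp
      ring
    have hd' : degreeIn G Y v ≤ 1 := (degreeIn_mono (Finset.subset_insert v Y) v).trans hd
    rw [hsum]
    rcases Y.eq_empty_or_nonempty with rfl | hY
    · exact ⟨1, le_rfl, by simp_all [degreeIn]⟩
    · obtain ⟨c, hc, h⟩ := ih hY (by omega)
      exact ⟨c + 1 - degreeIn G Y v, by omega, by omega⟩

end Degrees

/-! ### Balancing the inner vertices -/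

section Split

variable {V : Type*} [Fintype V]

/-- The vertices of degree at least `2`. -/
def innerVertices (G : SimpleGraph V) [DecidableRel G.Adj] : Finset V :=
  Finset.univ.filter fun x => 2 ≤ G.degree x

/-- The total weight of a vertex set, where a vertex of degree `d ≥ 1` has weight `d - 1`; so
leaves are weightless. Isolated vertices also get weight `0`, by truncated subtraction. -/
def excess (G : SimpleGraph V) [DecidableRel G.Adj] (X : Finset V) : ℕ :=
  ∑ x ∈ X, (G.degree x - 1)

/-- `(P, Q)` is a partition of `M` in which the weight of `P` exceeds that of `Q` by `D`, and the
vertex `e ∈ P` can absorb this difference: after the loss of `D` neighbors outside `M` it still has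
a neighbor, and if it loses any neighbor, then it has at most one neighbor in `P`. -/
structure IsSplit [DecidableEq V] (G : SimpleGraph V) [DecidableRel G.Adj] (M P Q : Finset V)
    (e : V) (D : ℕ) : Prop where
  disjoint : Disjoint P Q
  union_eq : P ∪ Q = M
  mem : e ∈ P
  excess_eq : excess G P = excess G Q + D
  add_one_le : D + 1 ≤ G.degree e
  add_degreeIn_le : D + degreeIn G M e ≤ G.degree e
  degreeIn_le_one : D ≠ 0 → degreeIn G P e ≤ 1

variable {G : SimpleGraph V} [DecidableRel G.Adj]

lemma card_le_excess {X : Finset V} (hX : ∀ x ∈ X, 2 ≤ G.degree x) : X.card ≤ excess G X := by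
  simpa [excess] using Finset.card_nsmul_le_sum X (fun x => G.degree x - 1) 1
    fun x hx => by have := hX x hx; omega

lemma excess_add_card {X : Finset V} (hX : ∀ x ∈ X, 1 ≤ G.degree x) :
    excess G X + X.card = ∑ x ∈ X, G.degree x := by
  rw [excess, Finset.card_eq_sum_ones, ← Finset.sum_add_distrib]
  exact Finset.sum_congr rfl fun x hx => Nat.sub_add_cancel (hX x hx)

variable [DecidableEq V]

lemma excess_insert {X : Finset V} {c : V} (hc : c ∉ X) :
    excess G (insert c X) = (G.degree c - 1) + excess G X :=
  Finset.sum_insert hc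

/-- Inner vertices are added one at a time, each having at most one neighbor among the earlier
ones. A new vertex goes to the lighter side; either it reduces the difference, which the old `e`
keeps absorbing, or it reverses the sign of the difference and becomes the new `e`. -/
lemma exists_isSplit (hG : G.IsAcyclic) {M : Finset V} (hM : M.Nonempty)
    (hdeg : ∀ x ∈ M, 2 ≤ G.degree x) : ∃ P Q e D, IsSplit G M P Q e D := by
  induction hn : M.card generalizing M with
  | zero => simp_all
  | succ n ih =>
    obtain ⟨c, hc, hd⟩ := exists_degreeIn_le_one hG hM
    have hc2 := hdeg c hc
    obtain ⟨K, hcK, rfl⟩ : ∃ K, c ∉ K ∧ M = insert c K :=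
      ⟨M.erase c, by simp, (Finset.insert_erase hc).symm⟩
    rw [Finset.card_insert_of_notMem hcK] at hn
    rcases K.eq_empty_or_nonempty with rfl | hK
    · refine ⟨{c}, ∅, c, G.degree c - 1, by simp, by simp, by simp, by simp [excess], by omega,
        by omega, fun _ => ?_⟩
      simpa using hd
    obtain ⟨P, Q, e, D, h⟩ := ih hK (fun x hx => hdeg x (Finset.mem_insert_of_mem hx)) (by omega)
    have hK' := h.union_eq
    have hcP : c ∉ P := fun hP => hcK (hK' ▸ Finset.mem_union_left _ hP)
    have hcQ : c ∉ Q := fun hQ => hcK (hK' ▸ Finset.mem_union_right _ hQ)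
    have hex := h.excess_eq
    by_cases hD : G.degree c - 1 ≤ D
    · refine ⟨P, insert c Q, e, D - (G.degree c - 1), ?_, ?_, h.mem, ?_, ?_, ?_, ?_⟩
      · simp [hcP, h.disjoint]
      · rw [Finset.union_insert, hK']
      · rw [excess_insert hcQ]
        omega
      · have := h.add_one_le
        omega
      · have := h.add_degreeIn_le
        rw [degreeIn_insert hcK]
        split_ifs <;> omega
      · exact fun _ => h.degreeIn_le_one (by omega)
    · refine ⟨insert c Q, P, c, G.degree c - 1 - D, ?_, ?_, by simp, ?_, by omega, by omega, ?_⟩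
      · simp [hcP, h.disjoint.symm]
      · rw [Finset.insert_union, Finset.union_comm, hK']
      · rw [excess_insert hcQ]
        omega
      · intro _
        refine (degreeIn_mono (Finset.insert_subset_insert c ?_) c).trans hd
        exact hK' ▸ Finset.subset_union_right

/-- A vertex of `Q` that is not adjacent to `e` can be moved to `P` if `e` can absorb the change. -/
lemma IsSplit.move {M P Q : Finset V} {e u : V} {D : ℕ} (h : IsSplit G M P Q e D) (hD : D ≠ 0)
    (hu : u ∈ Q) (heu : ¬ G.Adj e u) (h1 : D + 2 * (G.degree u - 1) + 1 ≤ G.degree e)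
    (h2 : D + 2 * (G.degree u - 1) + degreeIn G M e ≤ G.degree e) :
    IsSplit G M (insert u P) (Q.erase u) e (D + 2 * (G.degree u - 1)) := by
  have huP : u ∉ P := Finset.disjoint_right.1 h.disjoint hu
  refine ⟨?_, ?_, Finset.mem_insert_of_mem h.mem, ?_, h1, h2, fun _ => ?_⟩
  · rw [Finset.disjoint_insert_left]
    exact ⟨by simp, h.disjoint.mono_right (Finset.erase_subset _ _)⟩
  · rw [Finset.insert_union, ← Finset.union_insert, Finset.insert_erase hu, h.union_eq]
  · have hQ : excess G Q = (G.degree u - 1) + excess G (Q.erase u) := by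
      rw [← excess_insert (Finset.notMem_erase u Q), Finset.insert_erase hu]
    have := h.excess_eq
    rw [excess_insert huP]
    omega
  · rw [degreeIn_insert huP, if_neg heu]
    exact h.degreeIn_le_one hD

end Split

/-! ### Coloring the leaves -/

section Leaves

variable {V : Type*} [Fintype V] [DecidableEq V] {G : SimpleGraph V} [DecidableRel G.Adj]

/-- A subset `Z` of `X` of given size that meets `Y` in at most `t` elements. -/
lemma exists_subset_card_eq_inter_le {α : Type*} [DecidableEq α] {X Y : Finset α} {a t : ℕ}
    (h1 : a ≤ X.card) (h2 : a ≤ (X \ Y).card + t) :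
    ∃ Z ⊆ X, Z.card = a ∧ (Z ∩ Y).card ≤ t := by
  rcases le_total a (X \ Y).card with h | h
  · obtain ⟨Z, hZ, hZc⟩ := Finset.exists_subset_card_eq h
    refine ⟨Z, hZ.trans Finset.sdiff_subset, hZc, ?_⟩
    have : Z ∩ Y = ∅ := Finset.disjoint_iff_inter_eq_empty.1 (Finset.sdiff_disjoint.mono_left hZ)
    simp [this]
  · obtain ⟨Z, hXZ, hZX, hZc⟩ :=
      Finset.exists_subsuperset_card_eq (Finset.sdiff_subset (s := X) (t := Y)) h h1
    refine ⟨Z, hZX, hZc, ?_⟩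
    have h3 : Z \ Y = X \ Y := by
      ext x
      have h4 := @hZX x
      have h5 := @hXZ x
      simp only [Finset.mem_sdiff] at h5 ⊢
      tauto
    have h4 := Finset.card_sdiff_add_card_inter Z Y
    rw [h3] at h4
    omega

/-- If `e` has too many leaf neighbors, then some vertex of `Q` not adjacent to `e` is light enough
to be moved to `P`: heavy vertices in `Q` would make `Q` outweigh `P`. -/
lemma IsSplit.exists_movable {M P Q : Finset V} {e : V} {D : ℕ} (h : IsSplit G M P Q e D)
    (hdeg : ∀ x ∈ M, 2 ≤ G.degree x) (hD : D ≠ 0) (hDe : D + 1 < G.degree e)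
    (hbad : excess G Q + 3 ≤ Q.card + (G.degree e - D - degreeIn G M e) + degreeIn G P e) :
    ∃ u ∈ Q, ¬ G.Adj e u ∧ D + 2 * (G.degree u - 1) + 1 ≤ G.degree e ∧
      D + 2 * (G.degree u - 1) + degreeIn G M e ≤ G.degree e := by
  by_contra! hcon
  have hQM : ∀ x ∈ Q, 2 ≤ G.degree x := fun x hx =>
    hdeg x (h.union_eq ▸ Finset.mem_union_right _ hx)
  have hPM : ∀ x ∈ P, 2 ≤ G.degree x := fun x hx =>
    hdeg x (h.union_eq ▸ Finset.mem_union_left _ hx)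
  have hkA := h.degreeIn_le_one hD
  have hk : degreeIn G M e = degreeIn G P e + degreeIn G Q e := by
    rw [← h.union_eq, degreeIn_union h.disjoint]
  have hkD := h.add_degreeIn_le
  have hex := h.excess_eq
  -- `w` is the weight of `P` without `e`
  obtain ⟨w, hw⟩ : ∃ w, excess G P = (G.degree e - 1) + w := by
    refine ⟨excess G (P.erase e), ?_⟩
    rw [← excess_insert (Finset.notMem_erase e P), Finset.insert_erase h.mem]
  set Q₁ := Q.filter (G.Adj e) with hQ₁
  set Q₂ := Q.filter (fun u => ¬ G.Adj e u) with hQ₂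
  have hcard : Q₁.card + Q₂.card = Q.card := Finset.card_filter_add_card_filter_not _
  have hkB : degreeIn G Q e = Q₁.card := degreeIn_eq_card_filter Q e
  have hsum : excess G Q₁ + excess G Q₂ = excess G Q := Finset.sum_filter_add_sum_filter_not _ _ _
  have hQ₁e : Q₁.card ≤ excess G Q₁ :=
    card_le_excess fun x hx => hQM x (Finset.mem_filter.1 hx).1
  have hQ₂e : Q₂.card ≤ excess G Q₂ :=
    card_le_excess fun x hx => hQM x (Finset.mem_filter.1 hx).1
  -- twice the weight of each vertex of `Q₂` exceeds the slack `j` of `e`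
  obtain ⟨j, hj⟩ : ∃ j, G.degree e = D + max (degreeIn G M e) 1 + j :=
    Nat.exists_eq_add_of_le (by omega)
  have hQ₂j : Q₂.card * (j + 1) ≤ 2 * excess G Q₂ := by
    rw [excess, Finset.mul_sum, ← smul_eq_mul]
    refine Finset.card_nsmul_le_sum _ _ _ fun u hu => ?_
    rw [Finset.mem_filter] at hu
    have := hcon u hu.1 hu.2
    omega
  have hQ₂w : w + 2 ≤ Q₂.card := by omega
  have hmul : (w + 2) * (j + 1) ≤ 2 * excess G Q₂ := (Nat.mul_le_mul_right _ hQ₂w).trans hQ₂j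
  rcases j with _ | j
  · omega
  · have : (w + 2) * (j + 1 + 1) = w * j + 2 * w + 2 * j + 4 := by ring
    omega

/-- Good twins from a split of the inner vertices and a partition of the leaves into uncolored
leaves `R` at `e`, leaves `X` that join `P`, and leaves `Y` that join `Q`. Cross edges contribute
equally to the sums of the colored degrees over the two sides, so equality of these sums gives
equally many edges. -/
lemma IsSplit.isGoodTwins {P Q R X Y : Finset V} {e : V} {D : ℕ}
    (h : IsSplit G (innerVertices G) P Q e D)
    (hleaf : ∀ x, G.degree x = 1 ↔ x ∈ R ∨ x ∈ X ∨ x ∈ Y)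
    (hRX : Disjoint R X) (hRY : Disjoint R Y) (hXY : Disjoint X Y)
    (hR : ∀ x ∈ R, G.Adj e x) (hRD : R.card = D) (hcard : P.card + X.card = Q.card + Y.card)
    (he : D ≠ 0 → D + 1 < G.degree e → degreeIn G (P ∪ X) e ≤ 1) :
    IsGoodTwins G (P ∪ X) (Q ∪ Y) := by
  have hinner : ∀ x, 2 ≤ G.degree x ↔ x ∈ P ∨ x ∈ Q := fun x => by
    rw [← Finset.mem_union, h.union_eq, innerVertices]
    simp
  have hdisj : Disjoint (P ∪ X) (Q ∪ Y) := by
    have h1 : ∀ x ∈ P, x ∉ Y := fun x hx hy => by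
      have := (hinner x).2 (Or.inl hx)
      have := (hleaf x).2 (Or.inr (Or.inr hy))
      omega
    have h2 : ∀ x ∈ X, x ∉ Q := fun x hx hy => by
      have := (hinner x).2 (Or.inr hy)
      have := (hleaf x).2 (Or.inr (Or.inl hx))
      omega
    rw [Finset.disjoint_union_left, Finset.disjoint_union_right, Finset.disjoint_union_right]
    exact ⟨⟨h.disjoint, Finset.disjoint_left.2 h1⟩, Finset.disjoint_left.2 h2, hXY⟩
  have hPX : Disjoint P X := Finset.disjoint_left.2 fun x hx hy => by
    have := (hinner x).2 (Or.inl hx)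
    have := (hleaf x).2 (Or.inr (Or.inl hy))
    omega
  have hQY : Disjoint Q Y := Finset.disjoint_left.2 fun x hx hy => by
    have := (hinner x).2 (Or.inr hx)
    have := (hleaf x).2 (Or.inr (Or.inr hy))
    omega
  set C := (P ∪ X) ∪ (Q ∪ Y) with hC
  have hmemC : ∀ x, x ∈ C ↔ 1 ≤ G.degree x ∧ x ∉ R := fun x => by
    have hinnerR : 2 ≤ G.degree x → x ∉ R := fun hx hxR => by
      have := (hleaf x).2 (Or.inl hxR)
      omega
    simp only [hC, Finset.mem_union]
    constructor
    · rintro ((hx | hx) | (hx | hx))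
      · have := (hinner x).2 (Or.inl hx)
        exact ⟨by omega, hinnerR this⟩
      · exact ⟨((hleaf x).2 (Or.inr (Or.inl hx))).ge, Finset.disjoint_right.1 hRX hx⟩
      · have := (hinner x).2 (Or.inr hx)
        exact ⟨by omega, hinnerR this⟩
      · exact ⟨((hleaf x).2 (Or.inr (Or.inr hx))).ge, Finset.disjoint_right.1 hRY hx⟩
    · rintro ⟨hx, hxR⟩
      rcases hx.eq_or_lt with hx1 | hx2
      · rcases (hleaf x).1 hx1.symm with h1 | h1 | h1
        exacts [absurd h1 hxR, Or.inl (Or.inr h1), Or.inr (Or.inr h1)]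
      · rcases (hinner x).1 hx2 with h1 | h1
        exacts [Or.inl (Or.inl h1), Or.inr (Or.inl h1)]
  have hCR : Disjoint C R := Finset.disjoint_left.2 fun x hx => ((hmemC x).1 hx).2
  -- an uncolored leaf in `R` has no neighbor other than `e`
  have hRe : ∀ x u, u ∈ R → G.Adj x u → x = e := fun x u hu hxu => by
    have h1 : G.degree u = 1 := (hleaf u).2 (Or.inl hu)
    rw [← SimpleGraph.card_neighborFinset_eq_degree] at h1
    exact Finset.card_le_one.1 h1.le x (by simpa using hxu.symm) e (by simpa using (hR u hu).symm)
  have hdegR : ∀ x, degreeIn G R x = if x = e then D else 0 := fun x => by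
    rw [degreeIn_eq_card_filter]
    split_ifs with hx
    · rw [hx, Finset.filter_true_of_mem hR, hRD]
    · rw [Finset.filter_false_of_mem fun u hu hxu => hx (hRe x u hu hxu), Finset.card_empty]
  have hpos : ∀ x u, G.Adj x u → 1 ≤ G.degree u := fun x u hxu =>
    (G.degree_pos_iff_exists_adj u).2 ⟨x, hxu.symm⟩
  have hdegC : ∀ x, degreeIn G C x + (if x = e then D else 0) = G.degree x := fun x => by
    rw [← hdegR, ← degreeIn_union hCR, degreeIn, ← SimpleGraph.card_neighborFinset_eq_degree,
      Finset.inter_eq_left.2]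
    intro u hu
    have := hpos x u (by simpa using hu)
    rw [Finset.mem_union, hmemC]
    exact (em (u ∈ R)).symm.imp (fun huR => ⟨this, huR⟩) id
  have heC : e ∈ C := Finset.mem_union_left _ (Finset.mem_union_left _ h.mem)
  have hexp : ∀ x ∈ exposedSet G (P ∪ X) (Q ∪ Y), x = e ∧ D ≠ 0 := fun x hx => by
    obtain ⟨u, hu, huC⟩ := Finset.not_subset.1 (Finset.mem_filter.1 hx).2
    rw [SimpleGraph.mem_neighborFinset] at hu
    have huR : u ∈ R := by
      by_contra huR
      exact huC ((hmemC u).2 ⟨hpos x u hu, huR⟩)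
    exact ⟨hRe x u huR hu, hRD ▸ (Finset.card_pos.2 ⟨u, huR⟩).ne'⟩
  have hsumA : ∑ x ∈ P ∪ X, degreeIn G C x + D = excess G P + P.card + X.card := by
    have h1 : ∑ x ∈ P ∪ X, (if x = e then D else 0) = D := by
      rw [Finset.sum_ite_eq' (P ∪ X) e, if_pos (Finset.mem_union_left _ h.mem)]
    have h2 : ∑ x ∈ X, G.degree x = X.card := by
      rw [Finset.card_eq_sum_ones]
      exact Finset.sum_congr rfl fun x hx => (hleaf x).2 (Or.inr (Or.inl hx))
    rw [excess_add_card fun x hx => (le_of_lt ((hinner x).2 (Or.inl hx))), ← h2,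
      ← Finset.sum_union hPX]
    conv_lhs => rw [← h1]
    rw [← Finset.sum_add_distrib]
    exact Finset.sum_congr rfl fun x _ => hdegC x
  have hsumB : ∑ x ∈ Q ∪ Y, degreeIn G C x = excess G Q + Q.card + Y.card := by
    have h2 : ∑ x ∈ Y, G.degree x = Y.card := by
      rw [Finset.card_eq_sum_ones]
      exact Finset.sum_congr rfl fun x hx => (hleaf x).2 (Or.inr (Or.inr hx))
    rw [excess_add_card fun x hx => (le_of_lt ((hinner x).2 (Or.inr hx))), ← h2,
      ← Finset.sum_union hQY]
    refine Finset.sum_congr rfl fun x hx => ?_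
    have hxe : x ≠ e := fun hxe =>
      Finset.disjoint_left.1 hdisj (Finset.mem_union_left _ h.mem) (hxe ▸ hx)
    simpa [hxe] using hdegC x
  refine ⟨⟨hdisj, ?_, ?_⟩, ?_, ?_, ?_, ?_, ?_, ?_, ?_, ?_⟩
  · rw [Finset.card_union_of_disjoint hPX, Finset.card_union_of_disjoint hQY, hcard]
  · have h1 := sum_degreeIn_self (G := G) (P ∪ X)
    have h2 := sum_degreeIn_self (G := G) (Q ∪ Y)
    have h3 := sum_degreeIn_comm (G := G) (P ∪ X) (Q ∪ Y)
    have h4 := h.excess_eq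
    simp only [hC, degreeIn_union hdisj, Finset.sum_add_distrib] at hsumA hsumB
    omega
  · intro x hx
    by_contra! hx1
    refine hx ((hmemC x).2 ⟨by omega, fun hxR => ?_⟩)
    have := (hleaf x).2 (Or.inl hxR)
    omega
  · intro x hx
    have h1 := hdegC x
    have h2 := ((hmemC x).1 hx).1
    have h3 := h.add_one_le
    change degreeIn G C x ≠ 0
    split_ifs at h1 with hxe
    · subst hxe
      omega
    · omega
  · intro x hx
    exact Finset.mem_union_left _ ((hexp x hx).1 ▸ h.mem)
  · refine (Finset.card_le_one.2 fun x hx y hy => ?_).trans one_le_two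
    rw [(hexp x hx).1, (hexp y hy).1]
  · intro x hx y hy _ _
    rw [(hexp x hx).1, (hexp y hy).1]
  · intro x hx y hy _ _
    rw [(hexp x hx).1, (hexp y hy).1]
  · intro w hw hnon
    obtain ⟨rfl, hD⟩ := hexp w hw
    have h1 := hdegC w
    have h2 := hnon.2
    have h3 := h.add_one_le
    rw [if_pos rfl] at h1
    exact he hD (by rw [← hC] at h2; omega)
  · intro w hw v hv hnon hl
    rw [(hexp w hw).1] at hnon
    rw [(hexp v hv).1] at hl
    exact absurd hl.2 hnon.2

/-- If the colors of the leaves cannot be chosen suitably, then a vertex can be moved to `P`, which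
increases `D`; this terminates because `D` is less than the degree of `e`. -/
lemma IsSplit.exists_isGoodTwins (hG : G.IsAcyclic) {P Q : Finset V} {e : V} {D : ℕ}
    (h : IsSplit G (innerVertices G) P Q e D) : ∃ A B : Finset V, IsGoodTwins G A B := by
  induction hn : G.degree e - D using Nat.strong_induction_on generalizing P Q D with
  | _ n ih =>
  set N := innerVertices G with hN
  have hNdeg : ∀ x ∈ N, 2 ≤ G.degree x := fun x hx => by simpa [hN, innerVertices] using hx
  set L : Finset V := Finset.univ.filter fun x => G.degree x = 1 with hL
  have hNL : Disjoint N L := Finset.disjoint_left.2 fun x hx hxL => by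
    have := hNdeg x hx
    have := (Finset.mem_filter.1 hxL).2
    omega
  have hnb : ∀ x, G.neighborFinset x ⊆ N ∪ L := fun x u hu => by
    have : 1 ≤ G.degree u :=
      (G.degree_pos_iff_exists_adj u).2 ⟨x, by simpa [G.adj_comm] using hu⟩
    simp only [hN, hL, innerVertices, Finset.mem_union, Finset.mem_filter, Finset.mem_univ,
      true_and]
    omega
  have hdegNL : ∀ x, degreeIn G (N ∪ L) x = G.degree x := fun x => by
    rw [degreeIn, Finset.inter_eq_left.2 (hnb x), SimpleGraph.card_neighborFinset_eq_degree]
  have heN : e ∈ N := h.union_eq ▸ Finset.mem_union_left _ h.mem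
  have hPN : P ⊆ N := h.union_eq ▸ Finset.subset_union_left
  have hQN : Q ⊆ N := h.union_eq ▸ Finset.subset_union_right
  -- the number of leaves of the forest, in terms of the weights and the number `c` of components
  obtain ⟨c, hc, hcount⟩ := exists_sum_degreeIn_add_two_mul hG (X := N ∪ L) ⟨e, by simp [heN]⟩
  have hleaves : L.card + P.card + Q.card = 2 * c + 2 * excess G Q + D := by
    have h1 : ∑ x ∈ L, G.degree x = L.card := by
      rw [Finset.card_eq_sum_ones]
      exact Finset.sum_congr rfl fun x hx => (Finset.mem_filter.1 hx).2
    have h2 := excess_add_card fun x hx => one_le_two.trans (hNdeg x hx)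
    have h3 : excess G N = excess G P + excess G Q := by
      rw [← h.union_eq]
      exact Finset.sum_union h.disjoint
    have h4 : N.card = P.card + Q.card := by
      rw [← h.union_eq, Finset.card_union_of_disjoint h.disjoint]
    have h5 := h.excess_eq
    simp only [hdegNL] at hcount
    rw [Finset.sum_union hNL, Finset.card_union_of_disjoint hNL] at hcount
    omega
  -- `D` of the leaves at `e` stay uncolored
  have hdegL : degreeIn G N e + degreeIn G L e = G.degree e := by
    rw [← degreeIn_union hNL, hdegNL]
  have hDL : D ≤ (L.filter (G.Adj e)).card := by
    have := h.add_degreeIn_le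
    rw [← degreeIn_eq_card_filter]
    omega
  obtain ⟨R, hRsub, hRD⟩ := Finset.exists_subset_card_eq hDL
  have hRL : R ⊆ L := hRsub.trans (Finset.filter_subset _ _)
  have hRadj : ∀ x ∈ R, G.Adj e x := fun x hx => (Finset.mem_filter.1 (hRsub hx)).2
  have hLR : (L \ R).card = L.card - D := by rw [Finset.card_sdiff_of_subset hRL, hRD]
  have hPle : P.card ≤ excess G Q + 1 := by
    have h1 : (P.erase e).card ≤ excess G (P.erase e) :=
      card_le_excess fun x hx => hNdeg x (hPN (Finset.mem_of_mem_erase hx))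
    have h2 : excess G P = (G.degree e - 1) + excess G (P.erase e) := by
      rw [← excess_insert (Finset.notMem_erase e P), Finset.insert_erase h.mem]
    rw [Finset.card_erase_of_mem h.mem] at h1
    have h3 := h.add_one_le
    have h4 := h.excess_eq
    omega
  have hQle : Q.card ≤ excess G Q := card_le_excess fun x hx => hNdeg x (hQN hx)
  -- balance of the cardinalities forces the number of leaves that join `P`
  have finish : ∀ X ⊆ L \ R, X.card = c + excess G Q - P.card →
      (D ≠ 0 → D + 1 < G.degree e → degreeIn G (P ∪ X) e ≤ 1) →
      ∃ A B : Finset V, IsGoodTwins G A B := by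
    intro X hX hXc hXe
    refine ⟨_, _, h.isGoodTwins (R := R) (X := X) (Y := (L \ R) \ X) (fun x => ?_) ?_ ?_
      Finset.disjoint_sdiff hRadj hRD ?_ hXe⟩
    · have h1 : x ∈ L ↔ G.degree x = 1 := by simp [hL]
      have h2 := @hRL x
      have h3 := @hX x
      rw [← h1]
      simp only [Finset.mem_sdiff] at h3 ⊢
      tauto
    · exact Finset.disjoint_sdiff.mono_right hX
    · exact Finset.disjoint_sdiff.mono_right Finset.sdiff_subset
    · rw [Finset.card_sdiff_of_subset hX, hLR, hXc]
      omega
  by_cases hcon : D ≠ 0 ∧ D + 1 < G.degree e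
  swap
  · obtain ⟨X, hX, hXc⟩ := Finset.exists_subset_card_eq
      (s := L \ R) (n := c + excess G Q - P.card) (by omega)
    exact finish X hX hXc fun h1 h2 => absurd ⟨h1, h2⟩ hcon
  obtain ⟨hD, hDe⟩ := hcon
  have hkA := h.degreeIn_le_one hD
  set F := L.filter (G.Adj e) with hF
  have hFcard : F.card = degreeIn G L e := (degreeIn_eq_card_filter L e).symm
  have hLRF : ((L \ R) \ F).card = L.card - F.card := by
    have : (L \ R) \ F = L \ F := by
      rw [sdiff_sdiff_left, Finset.sup_eq_union, Finset.union_eq_right.2 hRsub]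
    rw [this, Finset.card_sdiff_of_subset (Finset.filter_subset _ _)]
  have hFL : F.card ≤ L.card := Finset.card_filter_le _ _
  by_cases ha : c + excess G Q - P.card ≤ ((L \ R) \ F).card + (1 - degreeIn G P e)
  · obtain ⟨X, hX, hXc, hXF⟩ := exists_subset_card_eq_inter_le (X := L \ R) (by omega) ha
    refine finish X hX hXc fun _ _ => ?_
    have hXL : X ⊆ L := hX.trans Finset.sdiff_subset
    rw [degreeIn_union (hNL.mono hPN hXL)]
    have : degreeIn G X e ≤ (X ∩ F).card := by
      rw [degreeIn_eq_card_filter]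
      refine Finset.card_le_card fun x hx => ?_
      rw [Finset.mem_filter] at hx
      simp [hF, hx.1, hx.2, hXL hx.1]
    omega
  · obtain ⟨u, hu, heu, h1, h2⟩ := h.exists_movable hNdeg hD hDe (by
      have := h.add_degreeIn_le
      omega)
    have hu2 := hNdeg u (hQN hu)
    exact ih _ (by omega) (h.move hD hu heu h1 h2) rfl

end Leaves

theorem mainTheorem5 {V : Type*} [Fintype V] [DecidableEq V] (G : SimpleGraph V)
    [DecidableRel G.Adj] (hG : G.IsAcyclic) :
    ∃ A B : Finset V, IsGoodTwins G A B := by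
  rcases (innerVertices G).eq_empty_or_nonempty with hN | hN
  · refine ⟨∅, ∅, ⟨⟨by simp, rfl, rfl⟩, fun x _ => ?_, ?_, ?_, ?_, ?_, ?_, ?_, ?_⟩⟩
    · by_contra hx
      have : x ∈ innerVertices G := by
        rw [innerVertices, Finset.mem_filter]
        exact ⟨Finset.mem_univ x, by omega⟩
      simp [hN] at this
    all_goals simp [exposedSet]
  · obtain ⟨P, Q, e, D, h⟩ := exists_isSplit hG hN fun x hx => by
      simpa [innerVertices] using hx
    exact h.exists_isGoodTwins hG
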